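/- For a topological group $G$, a discrete $G$-module is an abelian group $A$ with the discrete topology and an action of $G$ by automorphisms such that $G\times A\to A$ is continuous, and $H^k(G,A)$ denotes continuous cohomology; an abstract group carries the discrete topology, so that this is ordinary group cohomology. Let $\widehat H$ be the profinite completion of a group $H$. The group $H$ is cohomologically good if for every finite discrete $\widehat H$-module $A$ and every $k\ge 0$ the natural map $H\to\widehat H$ induces an isomorphism $H^k(\widehat H,A)\to H^k(H,A)$. The cohomological dimension $\mathrm{cd}(H)$ of an abstract group $H$ is the least $n\in\mathbb{N}\cup\{0,\infty\}$ such that $H^k(H,A)=0$ for all $k>n$ and all $\mathbb{Z}[H]$-modules $A$. For a profinite group $G$ and a prime $p$, $\mathrm{cd}_p(G)$ is the least $n\in\mathbb{N}\cup\{0,\infty\}$ such that the $p$-primary component of $H^k(G,A)$ vanishes for all $k>n$ and all discrete torsion $G$-modules $A$, and $\mathrm{cd}(G)=\sup\{\mathrm{cd}_p(G)\mid p \text{ prime}\}$. Lemma. Suppose that $H$ is a cohomologically good group with $\mathrm{cd}(H)=n<\infty$. Then $\mathrm{cd}(\widehat H)\le n$, and $\widehat H$ is torsion-free, i.e. it has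 no non-trivial element of finite order. -/

import Mathlib

open CategoryTheory

universe u

noncomputable section

namespace GoodGroups

/-- The profinite completion `Ĥ` of an abstract group `H`. -/
abbrev Completion (H : Type u) [Group H] : ProfiniteGrp.{u} :=
  ProfiniteGrp.ProfiniteCompletion.completion (GrpCat.of H)

/-- The canonical homomorphism `H → Ĥ`. The abstract group `H` carries the discrete topology, so it
is continuous. -/
def toCompletion (H : Type u) [Group H] [TopologicalSpace H] [DiscreteTopology H] :
    H →ₜ* Completion H where
  toMonoidHom := (ProfiniteGrp.ProfiniteCompletion.eta (GrpCat.of H)).hom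
  continuous_toFun := continuous_of_discreteTopology

/-- `A` is a discrete `G`-module: an abelian group with the discrete topology on which `G` acts by
automorphisms such that the action `G × A → A` is continuous. If `G` is discrete, these are
exactly the `ℤ[G]`-modules. -/
structure IsDiscreteModule {G : Type u} [Group G] [TopologicalSpace G]
    (A : TopRep.{u} ℤ G) : Prop where
  discrete : DiscreteTopology A
  continuous_action : Continuous fun x : G × A => A.ρ x.1 x.2

/-- A group `H` (with the discrete topology) is cohomologically good if for every finite discrete
`Ĥ`-module `A` and every `k` the canonical map `H → Ĥ` induces an isomorphism from the (continuous)
cohomology `H^k(Ĥ, A)` to the cohomology `H^k(H, A)`. -/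
def IsCohomologicallyGood (H : Type u) [Group H] [TopologicalSpace H] [DiscreteTopology H] :
    Prop :=
  ∀ A : TopRep.{u} ℤ (Completion H), IsDiscreteModule A → Finite A → ∀ k : ℕ,
    Function.Bijective
      (ContinuousCohomology.map (toCompletion H)
        (𝟙 (TopRep.res (toCompletion H : H →* Completion H) A)) k)

/-- The cohomological dimension of an abstract group `H` (with the discrete topology, so that
continuous cohomology is ordinary group cohomology): the least `n ∈ ℕ ∪ {∞}` with `H^k(H, A) = 0`
for all `k > n` and all `ℤ[H]`-modules `A`. -/
def cd (H : Type u) [Group H] [TopologicalSpace H] [DiscreteTopology H] : ℕ∞ :=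
  sInf {n : ℕ∞ | ∀ k : ℕ, n < k → ∀ A : TopRep.{u} ℤ H, IsDiscreteModule A →
    Subsingleton (continuousCohomology k A)}

/-- The cohomological `p`-dimension of a profinite group `G`: the least `n ∈ ℕ ∪ {∞}` such that for
all `k > n` and all discrete torsion `G`-modules `A` the `p`-primary component of `H^k(G, A)`
vanishes. -/
def profiniteCdAt (p : ℕ) (G : ProfiniteGrp.{u}) : ℕ∞ :=
  sInf {n : ℕ∞ | ∀ k : ℕ, n < k → ∀ A : TopRep.{u} ℤ G, IsDiscreteModule A →
    (∀ a : A, IsOfFinAddOrder a) →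
    ∀ x : continuousCohomology k A, (∃ m : ℕ, p ^ m • x = 0) → x = 0}

/-- The cohomological dimension of a profinite group `G`: the supremum of its cohomological
`p`-dimensions over all primes `p`. -/
def profiniteCd (G : ProfiniteGrp.{u}) : ℕ∞ :=
  ⨆ (p : ℕ) (_ : p.Prime), profiniteCdAt p G

end GoodGroups

end

/-! For a finite discrete Ĥ-module B and k > n, goodness identifies H^k(Ĥ, B) with H^k(H, B) = 0
(`isContAcyclicAt_completion`). By compactness, a continuous cocycle with values in a discrete
torsion module takes finitely many values, so it lives in a finite submodule. Hence vanishing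
extends to torsion modules (`isContAcyclicAt_of_torsion`), which bounds the cohomological dimension.

If g ≠ 1 in Ĥ has finite order, the cyclic group C = ⟨g⟩ embeds in a finite quotient of Ĥ, and
coinduction as in Shapiro's lemma transfers the vanishing in degree n + 1 to all finite C-modules
(`isAcyclicAt_of_injective`). Every finite C-module A is a quotient of the finite acyclic module of
functions C → A, so dimension shifting lowers the degree to 1 (`isAcyclicAt_of_le`). But H^1(C, C) =
Hom(C, C) ≠ 0 for the trivial action (`not_isAcyclicAt_one`).

The arguments use homogeneous cochains, written as functions of lists: degree k means length k + 1.
The map `evalList` translates them from the iterated spaces C(G, C(G, …)) that define continuous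
cohomology. -/

noncomputable section

namespace GoodGroups

/-! ### The homogeneous coboundary on functions of lists. -/

section Coboundary

variable {G G' A B : Type*} [AddCommGroup A] [AddCommGroup B]

/-- The alternating coboundary `f(g₁, …, gₙ) - f(g₀, g₂, …, gₙ) + ⋯` of a function of finite
sequences. -/
def coboundary : (List G → A) → List G → A
  | _, [] => 0
  | f, g :: l => f l - coboundary (fun w => f (g :: w)) l

@[simp]
lemma coboundary_nil (f : List G → A) : coboundary f [] = 0 := rfl

lemma coboundary_cons (f : List G → A) (g : G) (l : List G) :
    coboundary f (g :: l) = f l - coboundary (fun w => f (g :: w)) l := rfl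

lemma coboundary_comp_map (r : G → G') (f : List G' → A) (l : List G) :
    coboundary (fun w => f (w.map r)) l = coboundary f (l.map r) := by
  induction l generalizing f with
  | nil => rfl
  | cons g l ih =>
    simp only [coboundary_cons, List.map_cons]
    rw [ih fun w => f (r g :: w)]

lemma coboundary_addMonoidHom (φ : A →+ B) (f : List G → A) (l : List G) :
    coboundary (fun w => φ (f w)) l = φ (coboundary f l) := by
  induction l generalizing f with
  | nil => simp
  | cons g l ih => simp [coboundary_cons, ih fun w => f (g :: w)]

lemma coboundary_zero (l : List G) : coboundary (fun _ => (0 : A)) l = 0 := by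
  induction l with
  | nil => rfl
  | cons g l ih => simp [coboundary_cons, ih]

lemma coboundary_sub (f f' : List G → A) (l : List G) :
    coboundary (fun w => f w - f' w) l = coboundary f l - coboundary f' l := by
  induction l generalizing f f' with
  | nil => simp
  | cons g l ih =>
    rw [coboundary_cons, ih (fun w => f (g :: w)) fun w => f' (g :: w), coboundary_cons,
      coboundary_cons]
    abel

lemma coboundary_congr {f f' : List G → A} {l : List G}
    (h : ∀ w, w.length + 1 = l.length → f w = f' w) : coboundary f l = coboundary f' l := by
  induction l generalizing f f' with
  | nil => rfl
  | cons g l ih =>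
    rw [coboundary_cons, coboundary_cons, h l (by simp)]
    congr 1
    exact ih fun w hw => h _ (by simpa using hw)

lemma coboundary_coboundary (f : List G → A) (l : List G) :
    coboundary (coboundary f) l = 0 := by
  induction l generalizing f with
  | nil => rfl
  | cons g l ih =>
    rw [coboundary_cons]
    simp only [coboundary_cons]
    rw [coboundary_sub f (coboundary fun w => f (g :: w)), ih]
    simp

end Coboundary

/-! ### Equivariant cochains and acyclicity of coinduced modules. -/

section Equivariant

variable {G A : Type*} [Group G] [AddCommGroup A]

lemma action_mul (ρ : G →* AddMonoid.End A) (g h : G) (a : A) : ρ (g * h) a = ρ g (ρ h a) := by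
  rw [map_mul]
  rfl

@[simp]
lemma action_one (ρ : G →* AddMonoid.End A) (a : A) : ρ 1 a = a := by
  rw [map_one]
  rfl

@[simp]
lemma action_inv_self (ρ : G →* AddMonoid.End A) (g : G) (a : A) : ρ g⁻¹ (ρ g a) = a := by
  rw [← action_mul, inv_mul_cancel, action_one]

@[simp]
lemma action_self_inv (ρ : G →* AddMonoid.End A) (g : G) (a : A) : ρ g (ρ g⁻¹ a) = a := by
  rw [← action_mul, mul_inv_cancel, action_one]

/-- Homogeneous cochains: functions of finite sequences that are equivariant for the diagonal
translation action. -/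
def IsEquivariant (ρ : G →* AddMonoid.End A) (f : List G → A) : Prop :=
  ∀ g l, f (l.map (g * ·)) = ρ g (f l)

lemma IsEquivariant.sub {ρ : G →* AddMonoid.End A} {f f' : List G → A} (hf : IsEquivariant ρ f)
    (hf' : IsEquivariant ρ f') : IsEquivariant ρ fun l => f l - f' l := fun g l => by
  simp [hf g l, hf' g l]

lemma IsEquivariant.coboundary {ρ : G →* AddMonoid.End A} {f : List G → A}
    (hf : IsEquivariant ρ f) : IsEquivariant ρ (coboundary f) := fun g l => by
  rw [← coboundary_comp_map]
  exact (congrArg (fun f' => GoodGroups.coboundary f' l) (funext (hf g))).trans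
    (coboundary_addMonoidHom (ρ g) f l)

/-- Every homogeneous cocycle of degree `k` is a coboundary: `H^k(G, A) = 0` for the abstract
group `G`. Here `k` is positive in all applications. -/
def IsAcyclicAt (ρ : G →* AddMonoid.End A) (k : ℕ) : Prop :=
  ∀ f : List G → A, IsEquivariant ρ f →
    (∀ l, l.length = k + 2 → GoodGroups.coboundary f l = 0) →
    ∃ e : List G → A, IsEquivariant ρ e ∧ ∀ l, l.length = k + 1 → GoodGroups.coboundary e l = f l

/-- The coinduced module of all functions `G → A`, on which `G` acts by right translation. -/
def rightRegular (G A : Type*) [Group G] [AddCommGroup A] : G →* AddMonoid.End (G → A) where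
  toFun g :=
    { toFun f x := f (x * g)
      map_zero' := rfl
      map_add' _ _ := rfl }
  map_one' := by ext f x; exact congrArg f (mul_one x)
  map_mul' g h := by ext f x; exact congrArg f (mul_assoc x g h).symm

@[simp]
lemma rightRegular_apply (g : G) (f : G → A) (x : G) : rightRegular G A g f x = f (x * g) := rfl

lemma map_mul_map_mul (x c : G) (l : List G) :
    (l.map (c * ·)).map (x * ·) = l.map ((x * c) * ·) := by
  simp [Function.comp_def, mul_assoc]

/-- Prepending 1 is a contracting homotopy of the non-equivariant complex; translating by x and
evaluating at 1 makes the primitive equivariant. -/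
lemma isAcyclicAt_rightRegular (k : ℕ) : IsAcyclicAt (rightRegular G A) k := by
  intro f hf hc
  refine ⟨fun l x => f (1 :: l.map (x * ·)) 1, fun c l => ?_, fun l hl => ?_⟩
  · funext x
    simp only [rightRegular_apply, map_mul_map_mul]
  · funext x
    have h1 := coboundary_addMonoidHom (Pi.evalAddMonoidHom (fun _ : G => A) x)
      (fun l x => f (1 :: l.map (x * ·)) 1) l
    have h2 := coboundary_comp_map (x * ·) (fun w => f (1 :: w) 1) l
    have h3 := coboundary_addMonoidHom (Pi.evalAddMonoidHom (fun _ : G => A) 1)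
      (fun w => f (1 :: w)) (l.map (x * ·))
    have h4 := congrFun (hc (1 :: l.map (x * ·)) (by simp [hl])) 1
    rw [coboundary_cons, Pi.sub_apply, Pi.zero_apply, sub_eq_zero, hf x l,
      rightRegular_apply, one_mul] at h4
    simp only [Pi.evalAddMonoidHom_apply] at h1 h2 h3
    rw [← h1, h2, h3, ← h4]

end Equivariant

/-! ### Dimension shifting for finite groups. -/

section FiniteGroup

variable {C : Type u} [Group C]

/-- The equivariant projection of the coinduced module of a finite group onto `A`. -/
def normMap {A : Type u} [AddCommGroup A] (ρ : C →* AddMonoid.End A) : (C → A) →+ A :=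
  ∑ᶠ x, (ρ x⁻¹).comp (Pi.evalAddMonoidHom (fun _ : C => A) x)

lemma normMap_apply [Fintype C] {A : Type u} [AddCommGroup A] (ρ : C →* AddMonoid.End A)
    (φ : C → A) : normMap ρ φ = ∑ x, ρ x⁻¹ (φ x) := by
  rw [normMap, finsum_eq_sum_of_fintype, AddMonoidHom.finsetSum_apply]
  rfl

lemma normMap_rightRegular [Finite C] {A : Type u} [AddCommGroup A]
    (ρ : C →* AddMonoid.End A) (c : C)
    (φ : C → A) : normMap ρ (rightRegular C A c φ) = ρ c (normMap ρ φ) := by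
  have := Fintype.ofFinite C
  rw [normMap_apply, normMap_apply, map_sum]
  refine Fintype.sum_equiv (Equiv.mulRight c) _ _ fun x => ?_
  simp

lemma normMap_single [DecidableEq C] [Finite C] {A : Type u} [AddCommGroup A]
    (ρ : C →* AddMonoid.End A)
    (a : A) : normMap ρ (Pi.single 1 a) = a := by
  have := Fintype.ofFinite C
  rw [normMap_apply, Finset.sum_eq_single 1] <;> simp +contextual

/-- The kernel of `normMap` as a module. -/
def normKernel [Finite C] {A : Type u} [AddCommGroup A] (ρ : C →* AddMonoid.End A) :
    C →* AddMonoid.End (normMap ρ).ker where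
  toFun c := ((rightRegular C A c).comp (normMap ρ).ker.subtype).codRestrict _ fun φ => by
    rw [AddMonoidHom.mem_ker]
    exact (normMap_rightRegular ρ c φ).trans (by rw [φ.2, map_zero])
  map_one' := by ext φ x; exact congrArg φ.1 (mul_one x)
  map_mul' g h := by ext φ x; exact congrArg φ.1 (mul_assoc x g h).symm

lemma normKernel_apply [Finite C] {A : Type u} [AddCommGroup A] (ρ : C →* AddMonoid.End A) (c : C)
    (φ : (normMap ρ).ker) : (normKernel ρ c φ : C → A) = rightRegular C A c φ := rfl

open Classical in
lemma isAcyclicAt_of_succ [Finite C] {k : ℕ} {A : Type u} [AddCommGroup A]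
    (ρ : C →* AddMonoid.End A)
    (h : IsAcyclicAt (normKernel ρ) (k + 1)) : IsAcyclicAt ρ k := by
  intro f hf hc
  -- An equivariant lift of f through `normMap`: the additive section `Pi.single 1` is not
  -- equivariant, so it is conjugated by the first entry. The empty list has no first entry and gets
  -- 0.
  let s : List C → C → A
    | [] => 0
    | c :: t => rightRegular C A c (Pi.single 1 (ρ c⁻¹ (f (c :: t))))
  have hs : IsEquivariant (rightRegular C A) s := by
    rintro g (_ | ⟨c, t⟩)
    · simp [s]
    · have := hf g (c :: t)
      rw [List.map_cons] at this
      simp only [List.map_cons, s, this]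
      simp
  have hsf : ∀ l, l ≠ [] → normMap ρ (s l) = f l := by
    rintro (_ | ⟨c, t⟩) hl
    · exact absurd rfl hl
    · simp only [s]
      rw [normMap_rightRegular, normMap_single]
      simp
  have hker : ∀ l, l.length = k + 2 → normMap ρ (coboundary s l) = 0 := by
    intro l hl
    rw [← hc l hl]
    refine (coboundary_addMonoidHom (normMap ρ) s l).symm.trans
      (coboundary_congr fun w hw => hsf w ?_)
    rintro rfl
    simp [hl] at hw
  -- The connecting homomorphism applied to f, cut off outside the length where it is known to lie
  -- in the kernel.
  let t : List C → (normMap ρ).ker := fun l =>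
    if hl : l.length = k + 2 then ⟨coboundary s l, hker l hl⟩ else 0
  have ht : ∀ l, l.length = k + 2 → (t l : C → A) = coboundary s l := fun l hl => by
    simp [t, hl]
  have htc : ∀ l, l.length = k + 1 + 2 → coboundary t l = 0 := by
    intro l hl
    apply Subtype.ext
    refine (coboundary_addMonoidHom
      ((normMap ρ).ker).subtype t l).symm.trans ?_
    refine (coboundary_congr fun w hw => ht w (by omega)).trans (coboundary_coboundary s l)
  have hte : IsEquivariant (normKernel ρ) t := by
    intro g l
    apply Subtype.ext
    rw [normKernel_apply]
    by_cases hl : l.length = k + 2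
    · rw [ht _ (by simpa using hl), ht _ hl, hs.coboundary g l]
    · simp [t, hl]
  obtain ⟨e, he, het⟩ := h t hte htc
  -- Correcting s by e gives a cocycle that still lifts f, now in an acyclic module.
  have hes : IsEquivariant (rightRegular C A) fun l => s l - e l :=
    hs.sub fun g l => by rw [he g l, normKernel_apply]
  obtain ⟨e', he', hee'⟩ := isAcyclicAt_rightRegular (G := C) (A := A) k _ hes fun l hl => by
    rw [coboundary_sub, ← ht l hl, ← het l (by omega), sub_eq_zero]
    exact (coboundary_addMonoidHom ((normMap ρ).ker).subtype e l).symm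
  refine ⟨fun l => normMap ρ (e' l), fun g l => ?_, fun l hl => ?_⟩
  · simp only [he' g l, normMap_rightRegular]
  · refine (coboundary_addMonoidHom (normMap ρ) e' l).trans ?_
    change normMap ρ _ = _
    rw [hee' l hl, map_sub, hsf, (e l).2, sub_zero]
    rintro rfl
    simp at hl

lemma isAcyclicAt_of_le [Finite C] {n : ℕ}
    (h : ∀ (A : Type u) [AddCommGroup A] [Finite A] (ρ : C →* AddMonoid.End A), IsAcyclicAt ρ n)
    {k : ℕ} (hk : k ≤ n) (A : Type u) [AddCommGroup A] [Finite A] (ρ : C →* AddMonoid.End A) :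
    IsAcyclicAt ρ k := by
  induction hk using Nat.decreasingInduction generalizing A with
  | self => exact h A ρ
  | of_succ k hk ih => exact isAcyclicAt_of_succ ρ (ih _ _)

end FiniteGroup

/-- The cocycle (x, y) ↦ x⁻¹y represents the identity in Hom(C, C). For the trivial action an
equivariant 0-cochain is constant, so its coboundary is zero. -/
lemma not_isAcyclicAt_one {C : Type*} [CommGroup C] [Nontrivial C] :
    ¬ IsAcyclicAt (1 : C →* AddMonoid.End (Additive C)) 1 := by
  intro h
  let f : List C → Additive C
    | [x, y] => Additive.ofMul (x⁻¹ * y)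
    | _ => 0
  obtain ⟨e, he, hef⟩ := h f (fun g l => by
      rcases l with _ | ⟨x, _ | ⟨y, _ | ⟨z, l⟩⟩⟩ <;> simp [f]) (fun l hl => by
      obtain ⟨x, y, z, rfl⟩ := List.length_eq_three.1 hl
      simp only [coboundary_cons, coboundary_nil, f]
      apply Additive.toMul.injective
      simp [mul_comm])
  obtain ⟨c, hc⟩ := exists_ne (1 : C)
  have h1 := hef [1, c] rfl
  have h2 := he c [1]
  simp [coboundary_cons, f] at h1 h2
  rw [h2, sub_self] at h1
  exact hc (Additive.ofMul.injective h1.symm)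

/-! ### Homology of topological modules as kernel modulo image. -/

section Homology

variable {R : Type*} [Ring R] [TopologicalSpace R]

/-- The description of the homology of a complex of topological modules as kernel modulo image. -/
def topModuleHomologyData (S : ShortComplex (TopModuleCat R)) : S.LeftHomologyData :=
  ⟨_, _, _, _, _, TopModuleCat.isLimitKer _, by simp, TopModuleCat.isColimitCoker _⟩

lemma subsingleton_homology_iff (S : ShortComplex (TopModuleCat R)) :
    Subsingleton S.homology ↔ ∀ x, S.g.hom x = 0 → ∃ y, S.f.hom y = x := by
  let D := topModuleHomologyData S
  have hf (y : S.X₁) : (show S.g.hom.ker from D.f'.hom y).1 = S.f.hom y :=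
    congr($(D.f'_i).hom y)
  have e := ((forget (TopModuleCat R)).mapIso D.homologyIso).toEquiv
  rw [show Subsingleton S.homology ↔ Subsingleton (D.K ⧸ D.f'.hom.range) from
    e.subsingleton_congr, Submodule.Quotient.subsingleton_iff, LinearMap.range_eq_top]
  constructor
  · intro h x hx
    obtain ⟨y, hy⟩ := h ⟨x, hx⟩
    exact ⟨y, (hf y).symm.trans (congrArg Subtype.val hy)⟩
  · rintro h ⟨x, hx⟩
    obtain ⟨y, hy⟩ := h x hx
    exact ⟨y, Subtype.ext ((hf y).trans hy)⟩

end Homology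

/-- A continuous f has finitely many values, with compact fibres, so finitely many compact-open
conditions determine it. -/
lemma discreteTopology_continuousMap {X Y : Type*} [TopologicalSpace X] [CompactSpace X]
    [TopologicalSpace Y] [DiscreteTopology Y] : DiscreteTopology C(X, Y) := by
  rw [discreteTopology_iff_isOpen_singleton]
  intro f
  have hfin : (Set.range f).Finite := (isCompact_range f.continuous).finite_of_discrete
  have : ({f} : Set C(X, Y)) = ⋂ y ∈ Set.range f, {g : C(X, Y) | Set.MapsTo g (f ⁻¹' {y}) {y}} := by
    ext g
    simp only [Set.mem_singleton_iff, Set.mem_iInter, Set.mem_ofPred_eq]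
    refine ⟨by rintro rfl y _ x hx; exact hx, fun h => ?_⟩
    ext x
    exact h (f x) ⟨x, rfl⟩ rfl
  rw [this]
  exact hfin.isOpen_biInter fun y _ => ContinuousMap.isOpen_setOfPred_mapsTo
    ((isClosed_discrete {y}).preimage f.continuous).isCompact (isOpen_discrete _)

/-! ### Continuous cohomology in terms of functions of lists. -/

section Translation

open TopRep

variable {R : Type*} [Ring R] [TopologicalSpace R]

/-- The action on the additive group underlying a topological representation. -/
def additiveAction {G : Type u} [Group G] (A : TopRep.{u} R G) : G →* AddMonoid.End A where
  toFun g := (A.ρ g).toLinearMap.toAddMonoidHom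
  map_one' := by rw [map_one]; rfl
  map_mul' g h := by rw [map_mul]; rfl

variable {G : Type u} [Group G] [TopologicalSpace G] [IsTopologicalGroup G]

/-- The value of an element of `C(G, C(G, …, C(G, A)))` on a sequence of elements of `G`, zero for
sequences of the wrong length. -/
def evalList (A : TopRep.{u} R G) : (n : ℕ) → resolutionX A n → List G → A
  | 0, a, [] => a
  | 0, _, _ :: _ => 0
  | _ + 1, _, [] => 0
  | n + 1, f, g :: l => evalList A n ((f : C(G, resolutionX A n)) g) l

variable (A : TopRep.{u} R G)

lemma evalList_succ_cons (n : ℕ) (f : C(G, resolutionX A n)) (g : G) (l : List G) :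
    evalList A (n + 1) f (g :: l) = evalList A n (f g) l := rfl

lemma evalList_injective {n : ℕ} {f f' : resolutionX A n}
    (h : ∀ l, l.length = n → evalList A n f l = evalList A n f' l) : f = f' := by
  induction n with
  | zero => exact h [] rfl
  | succ n ih =>
    refine ContinuousMap.ext fun g => ih fun l hl => ?_
    exact h (g :: l) (by simp [hl])

lemma evalList_sub {n : ℕ} (f f' : resolutionX A n) (l : List G) :
    evalList A n (f - f') l = evalList A n f l - evalList A n f' l := by
  induction n generalizing l with
  | zero => cases l <;> simp [evalList]
  | succ n ih =>
    cases l with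
    | nil => simp [evalList]
    | cons g l => exact ih _ _ l

lemma evalList_zero {n : ℕ} (l : List G) : evalList A n 0 l = 0 := by
  rw [← sub_self (0 : resolutionX A n), evalList_sub, sub_self]

lemma evalList_smul {n : ℕ} (x : G) (f : resolutionX A n) (l : List G) :
    evalList A n ((resolutionX A n).ρ x f) (l.map (x * ·)) = A.ρ x (evalList A n f l) := by
  induction n generalizing l with
  | zero => cases l <;> simp [evalList]
  | succ n ih =>
    cases l with
    | nil => simp [evalList]
    | cons g l =>
      rw [List.map_cons, evalList_succ_cons, evalList_succ_cons, ← ih]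
      congr 1
      exact (ContRepresentation.coind₁_apply_apply _ _ _ _).trans (by simp)

lemma isEquivariant_evalList {n : ℕ} {f : resolutionX A n}
    (hf : f ∈ (resolutionX A n).ρ.invariants) :
    IsEquivariant (additiveAction A) (evalList A n f) := by
  intro g l
  conv_lhs => rw [← (ContRepresentation.mem_invariants _).1 hf g]
  exact evalList_smul A g f l

lemma evalList_d {n : ℕ} (f : resolutionX A n) (l : List G) :
    evalList A (n + 1) ((d A n).hom f) l = coboundary (evalList A n f) l := by
  induction n generalizing l with
  | zero =>
    rcases l with _ | ⟨g, _ | ⟨h, l⟩⟩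
    · rfl
    · exact (sub_zero _).symm
    · rw [coboundary_cons, evalList_succ_cons]
      simp only [evalList, coboundary_zero, sub_zero]
  | succ n ih =>
    cases l with
    | nil => rfl
    | cons g l =>
      rw [evalList_succ_cons, coboundary_cons]
      exact (evalList_sub A _ _ l).trans (congrArg _ (ih _ l))

/-- A function of finite sequences that factors through a quotient of `G` by an open normal
subgroup. -/
def IsUniform {B : Type*} (f : List G → B) : Prop :=
  ∃ U : OpenNormalSubgroup G, ∀ l l' : List G,
    l.map (QuotientGroup.mk : G → G ⧸ U.toSubgroup) = l'.map QuotientGroup.mk → f l = f l'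

lemma exists_evalList_eq {n : ℕ} {f : List G → A} (hf : IsUniform f) :
    ∃ F : resolutionX A n, ∀ l, l.length = n → evalList A n F l = f l := by
  induction n generalizing f with
  | zero =>
    refine ⟨f [], fun l hl => ?_⟩
    rw [List.length_eq_zero_iff.1 hl]
    rfl
  | succ n ih =>
    obtain ⟨U, hU⟩ := hf
    have hfg (g : G) : IsUniform fun l => f (g :: l) :=
      ⟨U, fun l l' h => hU _ _ (by simp [h])⟩
    choose F hF using fun g => ih (hfg g)
    -- F is constant on cosets of U, hence continuous for whatever topology the target carries.
    have hloc : IsLocallyConstant F := by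
      rw [IsLocallyConstant.iff_exists_open]
      intro g
      refine ⟨(fun x => g⁻¹ * x) ⁻¹' U, U.toOpenSubgroup.isOpen.preimage (by fun_prop), by simp,
        fun x hx => evalList_injective A fun l hl => ?_⟩
      rw [hF x l hl, hF g l hl]
      refine hU _ _ ?_
      rw [List.map_cons, List.map_cons, QuotientGroup.eq.2 hx]
    refine ⟨(⟨F, hloc.continuous⟩ : C(G, resolutionX A n)), fun l hl => ?_⟩
    cases l with
    | nil => simp at hl
    | cons g l => exact hF g l (by simpa using hl)

lemma discreteTopology_resolutionX [CompactSpace G] [DiscreteTopology A] (n : ℕ) :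
    DiscreteTopology (resolutionX A n) := by
  induction n with
  | zero => assumption
  | succ n ih => exact discreteTopology_continuousMap

lemma isUniform_evalList [CompactSpace G] [TotallyDisconnectedSpace G] [DiscreteTopology A]
    {n : ℕ} (F : resolutionX A n) : IsUniform (evalList A n F) := by
  have hone : Nonempty (OpenNormalSubgroup G) :=
    let ⟨U, _⟩ := ProfiniteGrp.exist_openNormalSubgroup_sub_open_nhds_of_one isOpen_univ
      (Set.mem_univ (1 : G))
    ⟨U⟩
  induction n with
  | zero =>
    refine ⟨hone.some, fun l l' h => ?_⟩
    cases l <;> cases l' <;> simp_all [evalList]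
  | succ n ih =>
    have := discreteTopology_resolutionX A n
    let F' : C(G, resolutionX A n) := F
    choose U hU using ih
    -- On gV the function F' is constant, and V is small enough for its value there. Finitely many
    -- such cosets cover G, and W below lies in all the chosen V.
    have hV (g : G) : ∃ V : OpenNormalSubgroup G, V ≤ U (F' g) ∧ ∀ v ∈ V, F' (g * v) = F' g := by
      obtain ⟨V, hV⟩ := ProfiniteGrp.exist_openNormalSubgroup_sub_open_nhds_of_one
        (((isOpen_discrete {F' g}).preimage (f := fun v => F' (g * v)) (by fun_prop)).inter
          (U (F' g)).toOpenSubgroup.isOpen) (by simp)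
      exact ⟨V, fun v hv => (hV hv).2, fun v hv => (hV hv).1⟩
    choose V hVU hV using hV
    obtain ⟨t, ht⟩ := isCompact_univ.elim_finite_subcover
      (fun g => (fun x => g⁻¹ * x) ⁻¹' (V g : Set G))
      (fun g => (V g).toOpenSubgroup.isOpen.preimage (by fun_prop))
      fun g _ => Set.mem_iUnion.2 ⟨g, by simp⟩
    classical
    have hdir : Directed (· ≥ ·) (id : OpenNormalSubgroup G → OpenNormalSubgroup G) :=
      fun U U' => ⟨U ⊓ U', inf_le_left, inf_le_right⟩
    obtain ⟨W, hW⟩ := hdir.finset_le (t.image V)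
    refine ⟨W, fun l l' h => ?_⟩
    rcases l with _ | ⟨g, l⟩ <;> rcases l' with _ | ⟨g', l'⟩
    · rfl
    · simp at h
    · simp at h
    rw [List.map_cons, List.map_cons, List.cons.injEq] at h
    obtain ⟨x, hx, hgx⟩ := Set.mem_iUnion₂.1 (ht (Set.mem_univ g))
    have hWx : W ≤ V x := hW _ (Finset.mem_image_of_mem V hx)
    have hgx' : x⁻¹ * g' ∈ V x := by
      have := mul_mem hgx (hWx (QuotientGroup.eq.1 h.1))
      simpa [mul_assoc] using this
    have h1 : F' g = F' x := by simpa using hV x _ hgx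
    have h2 : F' g' = F' x := by simpa using hV x _ hgx'
    change evalList A n (F' g) l = evalList A n (F' g') l'
    rw [h1, h2]
    refine hU _ _ _ ?_
    have := congrArg (List.map (QuotientGroup.map W.toSubgroup (U (F' x)).toSubgroup
      (MonoidHom.id G) (hWx.trans (hVU x)))) h.2
    rwa [List.map_map, List.map_map] at this

/-- Every continuous homogeneous cocycle of degree `k` is a coboundary. -/
def IsContAcyclicAt {A : Type*} [AddCommGroup A] (ρ : G →* AddMonoid.End A) (k : ℕ) : Prop :=
  ∀ f : List G → A, IsEquivariant ρ f → IsUniform f →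
    (∀ l, l.length = k + 2 → coboundary f l = 0) →
    ∃ e : List G → A, IsEquivariant ρ e ∧ IsUniform e ∧
      ∀ l, l.length = k + 1 → coboundary e l = f l

/-- Cochains of degree k are the invariants of `resolutionX A (k + 1)`, whence the index shift. -/
lemma subsingleton_continuousCohomology_iff (k : ℕ) :
    Subsingleton (continuousCohomology (k + 1) A) ↔
      ∀ f ∈ (resolutionX A (k + 2)).ρ.invariants, (d A (k + 2)).hom f = 0 →
        ∃ e ∈ (resolutionX A (k + 1)).ρ.invariants, (d A (k + 1)).hom e = f := by
  let K := homogeneousCochains A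
  have e := ((forget (TopModuleCat R)).mapIso
    (K.homologyIsoSc' k (k + 1) (k + 2) (by simp) (by simp))).toEquiv
  rw [show Subsingleton (continuousCohomology (k + 1) A) ↔
    Subsingleton (K.sc' k (k + 1) (k + 2)).homology from e.subsingleton_congr,
    subsingleton_homology_iff]
  constructor
  · intro h f hf hfd
    obtain ⟨y, hy⟩ := h ⟨f, hf⟩ (Subtype.ext
      ((homogeneousCochains.d_apply A (k + 1) ⟨f, hf⟩).trans hfd))
    exact ⟨y.1, y.2, (homogeneousCochains.d_apply A k y).symm.trans (congrArg Subtype.val hy)⟩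
  · rintro h ⟨f, hf⟩ hfd
    obtain ⟨y, hy, hyf⟩ := h f hf ((homogeneousCochains.d_apply A (k + 1) ⟨f, hf⟩).symm.trans
      (congrArg Subtype.val hfd))
    exact ⟨⟨y, hy⟩, Subtype.ext ((homogeneousCochains.d_apply A k ⟨y, hy⟩).trans hyf)⟩

lemma mem_invariants_of_isEquivariant {n : ℕ} {f : List G → A}
    (hf : IsEquivariant (additiveAction A) f) {F : resolutionX A n}
    (hF : ∀ l, l.length = n → evalList A n F l = f l) : F ∈ (resolutionX A n).ρ.invariants := by
  rw [ContRepresentation.mem_invariants]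
  refine fun g => evalList_injective A fun l hl => ?_
  obtain ⟨l, rfl⟩ : ∃ l', l = l'.map (g * ·) := ⟨l.map (g⁻¹ * ·), by simp [Function.comp_def]⟩
  rw [evalList_smul, hF l (by simpa using hl), hF _ hl]
  exact (hf g l).symm

lemma subsingleton_continuousCohomology_iff_isContAcyclicAt [CompactSpace G]
    [TotallyDisconnectedSpace G] [DiscreteTopology A] (k : ℕ) :
    Subsingleton (continuousCohomology (k + 1) A) ↔
      IsContAcyclicAt (additiveAction A) (k + 1) := by
  rw [subsingleton_continuousCohomology_iff]
  constructor
  · intro h f hf hfu hfc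
    obtain ⟨F, hF⟩ := exists_evalList_eq A (n := k + 2) hfu
    obtain ⟨E, hE, hEF⟩ := h F (mem_invariants_of_isEquivariant A hf hF)
      (evalList_injective A fun l hl => by
        rw [evalList_d, evalList_zero, ← hfc l hl]
        exact coboundary_congr fun w hw => hF w (by omega))
    refine ⟨evalList A _ E, isEquivariant_evalList A hE, isUniform_evalList A E, fun l hl => ?_⟩
    rw [← evalList_d, hEF, hF l hl]
  · intro h F hF hFc
    obtain ⟨e, he, heu, hef⟩ := h _ (isEquivariant_evalList A hF) (isUniform_evalList A F)
      fun l _ => by rw [← evalList_d, hFc, evalList_zero]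
    obtain ⟨E, hE⟩ := exists_evalList_eq A (n := k + 1) heu
    refine ⟨E, mem_invariants_of_isEquivariant A he hE, evalList_injective A fun l hl => ?_⟩
    rw [evalList_d, ← hef l hl]
    exact coboundary_congr fun w hw => hE w (by omega)

end Translation

/-! ### Coinduction along an injection. -/

section Shapiro

variable {C Q A : Type*} [Group C] [Group Q] [AddCommGroup A]

/-- The additive group underlying the coinduced module along `j : C → Q`. -/
def coinducedGroup (j : C →* Q) (σ : C →* AddMonoid.End A) : AddSubgroup (Q → A) where
  carrier := {φ | ∀ c x, φ (j c * x) = σ c (φ x)}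
  zero_mem' c x := (map_zero (σ c)).symm
  add_mem' {φ ψ} hφ hψ c x := by simp [hφ c x, hψ c x]
  neg_mem' {φ} hφ c x := by simp [hφ c x]

/-- The coinduced module along `j : C → Q`, on which `Q` acts by right translation. -/
def coinduced (j : C →* Q) (σ : C →* AddMonoid.End A) :
    Q →* AddMonoid.End (coinducedGroup j σ) where
  toFun q := ((rightRegular Q A q).comp (coinducedGroup j σ).subtype).codRestrict _ fun φ c x =>
    (congrArg φ.1 (mul_assoc (j c) x q)).trans (φ.2 c (x * q))
  map_one' := by ext φ x; exact congrArg φ.1 (mul_one x)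
  map_mul' g h := by ext φ x; exact congrArg φ.1 (mul_assoc x g h).symm

lemma coinduced_apply (j : C →* Q) (σ : C →* AddMonoid.End A) (q : Q) (φ : coinducedGroup j σ)
    (x : Q) : (coinduced j σ q φ).1 x = φ.1 (x * q) := rfl

/-- The C-component with respect to a right transversal of j(C) is left C-equivariant; right
multiplication by a constant normalises it at 1. -/
lemma exists_equivariant_retraction {j : C →* Q} (hj : Function.Injective j) :
    ∃ r : Q → C, (∀ c x, r (j c * x) = c * r x) ∧ ∀ c, r (j c) = c := by
  obtain ⟨S, hS, -⟩ := j.range.exists_isComplement_right 1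
  let e := MonoidHom.ofInjective hj
  let s : Q → C := fun x => e.symm (hS.equiv x).1
  have hs (c : C) (x : Q) : s (j c * x) = c * s x := by
    have := hS.equiv_mul_left (e c) x
    simp only [s]
    rw [show j c = (e c : Q) from rfl, this, map_mul, MulEquiv.symm_apply_apply]
  refine ⟨fun x => s x * (s 1)⁻¹, fun c x => ?_, fun c => ?_⟩
  · simp only [hs, mul_assoc]
  · have := hs c 1
    rw [mul_one] at this
    simp [this]

end Shapiro

/-! ### Smooth modules, torsion coefficients and finite subgroups. -/

section ContinuousModules

variable {G : Type u} [Group G] [TopologicalSpace G]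

/-- Every element is fixed by an open normal subgroup. -/
def IsSmooth {A : Type*} [AddCommGroup A] (ρ : G →* AddMonoid.End A) : Prop :=
  ∀ a, ∃ U : OpenNormalSubgroup G, ∀ g ∈ U, ρ g a = a

/-- A `G`-module as a topological representation with the discrete topology. -/
def discreteRep {A : Type u} [AddCommGroup A] (ρ : G →* AddMonoid.End A) : TopRep.{u} ℤ G :=
  letI : TopologicalSpace A := ⊥
  haveI : DiscreteTopology A := ⟨rfl⟩
  TopRep.of (X := A) (.ofMonoidHom
    { toFun g := ⟨(ρ g : A →+ A).toIntLinearMap, continuous_of_discreteTopology⟩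
      map_one' := by ext a; exact action_one ρ a
      map_mul' g h := by ext a; exact action_mul ρ g h a })

variable [IsTopologicalGroup G]

lemma continuous_action_of_isSmooth {A : Type*} [AddCommGroup A] [TopologicalSpace A]
    [DiscreteTopology A] {ρ : G →* AddMonoid.End A} (hρ : IsSmooth ρ) :
    Continuous fun x : G × A => ρ x.1 x.2 := by
  refine IsLocallyConstant.continuous ((IsLocallyConstant.iff_exists_open _).2 ?_)
  rintro ⟨g, a⟩
  obtain ⟨U, hU⟩ := hρ a
  refine ⟨((fun x => g⁻¹ * x) ⁻¹' U) ×ˢ {a},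
    (U.toOpenSubgroup.isOpen.preimage (by fun_prop)).prod (isOpen_discrete _), by simp, ?_⟩
  rintro ⟨x, b⟩ ⟨hx, hb⟩
  obtain rfl : b = a := hb
  change ρ x b = ρ g b
  conv_rhs => rw [← hU _ hx, ← action_mul, mul_inv_cancel_left]

lemma isDiscreteModule_discreteRep {A : Type u} [AddCommGroup A] {ρ : G →* AddMonoid.End A}
    (hρ : IsSmooth ρ) : IsDiscreteModule (discreteRep ρ) where
  discrete := ⟨rfl⟩
  continuous_action :=
    @continuous_action_of_isSmooth G _ _ _ A _ ⊥ (@DiscreteTopology.mk A ⊥ rfl) ρ hρ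

variable [CompactSpace G]

lemma IsUniform.finite_values {B : Type*} {f : List G → B} (hf : IsUniform f) (n : ℕ) :
    (f '' {l | l.length = n}).Finite := by
  obtain ⟨U, hU⟩ := hf
  refine ((List.finite_length_eq (G ⧸ U.toSubgroup) n).image
    fun l => f (l.map Quotient.out)).subset ?_
  rintro _ ⟨l, hl, rfl⟩
  refine ⟨l.map QuotientGroup.mk, by simpa using hl, hU _ _ ?_⟩
  simp [Function.comp_def]

lemma isSmooth_additiveAction [TotallyDisconnectedSpace G] {A : TopRep.{u} ℤ G}
    (hA : IsDiscreteModule A) : IsSmooth (additiveAction A) := by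
  intro a
  have := hA.discrete
  obtain ⟨U, hU⟩ := ProfiniteGrp.exist_openNormalSubgroup_sub_open_nhds_of_one
    ((isOpen_discrete {a}).preimage (hA.continuous_action.comp (.prodMk_left a))) (by simp)
  exact ⟨U, fun g hg => hU hg⟩

lemma isContAcyclicAt_discreteRep [TotallyDisconnectedSpace G] {k : ℕ} {A : Type u} [AddCommGroup A]
    {ρ : G →* AddMonoid.End A} (h : Subsingleton (continuousCohomology (k + 1) (discreteRep.{u} ρ))) :
    IsContAcyclicAt ρ (k + 1) := by
  have : DiscreteTopology (discreteRep ρ) := ⟨rfl⟩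
  exact (subsingleton_continuousCohomology_iff_isContAcyclicAt (discreteRep ρ) k).1 h

/-- Vanishing of cohomology for finite modules implies vanishing for torsion modules. -/
lemma isContAcyclicAt_of_torsion {k : ℕ}
    (h : ∀ (B : Type u) [AddCommGroup B] [Finite B] (ρ : G →* AddMonoid.End B), IsSmooth ρ →
      IsContAcyclicAt ρ k)
    {A : Type u} [AddCommGroup A] {ρ : G →* AddMonoid.End A} (hρ : IsSmooth ρ)
    (hA : ∀ a : A, IsOfFinAddOrder a) : IsContAcyclicAt ρ k := by
  classical
  intro f hf hfu hfc
  -- B is G-stable by equivariance of f, and finite because it is finitely generated and torsion.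
  let B : AddSubgroup A := AddSubgroup.closure (f '' {l | l.length = k + 1})
  have hfB (l : List G) (hl : l.length = k + 1) : f l ∈ B :=
    AddSubgroup.subset_closure ⟨l, hl, rfl⟩
  have hB (g : G) : B ≤ B.comap (ρ g) := by
    rw [AddSubgroup.closure_le]
    rintro _ ⟨l, hl, rfl⟩
    have := hfB (l.map (g * ·)) (by simpa using hl)
    rwa [hf g l] at this
  have : Finite B := by
    have : Finite (f '' {l | l.length = k + 1}) := hfu.finite_values _
    have : AddGroup.FG B := AddGroup.closure_finite_fg _
    exact AddCommGroup.finite_of_fg_isAddTorsion B fun b =>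
      (AddSubmonoid.isOfFinAddOrder_coe (H := B.toAddSubmonoid)).1 (hA b)
  let ρB : G →* AddMonoid.End B :=
    { toFun g := ((ρ g).comp B.subtype).codRestrict B fun b => hB g b.2
      map_one' := by ext b; exact action_one ρ b.1
      map_mul' g h := by ext b; exact action_mul ρ g h b.1 }
  have hρB : IsSmooth ρB := fun b =>
    let ⟨U, hU⟩ := hρ b
    ⟨U, fun g hg => Subtype.ext (hU g hg)⟩
  let f' : List G → B := fun l => if hl : l.length = k + 1 then ⟨f l, hfB l hl⟩ else 0
  have hf' (l : List G) (hl : l.length = k + 1) : (f' l : A) = f l := by simp [f', hl]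
  obtain ⟨e, he, ⟨U, hU⟩, hef⟩ := h B ρB hρB f'
    (fun g l => by
      by_cases hl : l.length = k + 1
      · refine Subtype.ext ((hf' _ (by simpa using hl)).trans ((hf g l).trans ?_))
        exact congrArg (ρ g) (hf' l hl).symm
      · simp [f', hl])
    (by
      obtain ⟨U, hU⟩ := hfu
      refine ⟨U, fun l l' hl => ?_⟩
      have : l.length = l'.length := by simpa using congrArg List.length hl
      simp only [f', this, hU l l' hl])
    (fun l hl => Subtype.ext <| by
      refine (coboundary_addMonoidHom B.subtype f' l).symm.trans (Eq.trans ?_ (hfc l hl))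
      exact coboundary_congr fun w hw => hf' w (by omega))
  refine ⟨fun l => e l, fun g l => congrArg Subtype.val (he g l),
    ⟨U, fun l l' hl => congrArg Subtype.val (hU l l' hl)⟩, fun l hl => ?_⟩
  exact (coboundary_addMonoidHom B.subtype e l).trans
    ((congrArg Subtype.val (hef l hl)).trans (hf' l hl))

/-- Vanishing of the cohomology of `G` for finite modules passes to finite subgroups. -/
lemma isAcyclicAt_of_injective {k : ℕ}
    (h : ∀ (B : Type u) [AddCommGroup B] [Finite B] (ρ : G →* AddMonoid.End B), IsSmooth ρ →
      IsContAcyclicAt ρ k)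
    {C : Type u} [Group C] {j : C →* G} {U : OpenNormalSubgroup G}
    (hj : ∀ c, j c ∈ U → c = 1) {A : Type u} [AddCommGroup A] [Finite A]
    (σ : C →* AddMonoid.End A) : IsAcyclicAt σ k := by
  intro f hf hfc
  let q := QuotientGroup.mk' U.toSubgroup
  have hqj : Function.Injective (q.comp j) :=
    (injective_iff_map_eq_one _).2 fun c hc => hj c ((QuotientGroup.eq_one_iff _).1 hc)
  obtain ⟨r, hr, hrj⟩ := exists_equivariant_retraction hqj
  -- The pullback of f along r, as a cocycle of G with values in a finite module on which U acts
  -- trivially.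
  let F : List G → coinducedGroup (q.comp j) σ := fun l =>
    ⟨fun x => f ((l.map q).map fun y => r (x * y)), fun c x => by
      simp only [mul_assoc, hr]
      rw [← hf c, List.map_map (g := (c * ·))]
      rfl⟩
  have hFF (l : List G) (x : G ⧸ U.toSubgroup) :
      (coboundary F l).1 x = coboundary f ((l.map q).map fun y => r (x * y)) := by
    rw [← coboundary_comp_map (fun y => r (x * y)), ← coboundary_comp_map q]
    exact (coboundary_addMonoidHom ((Pi.evalAddMonoidHom (fun _ : G ⧸ U.toSubgroup => A) x).comp
      (coinducedGroup (q.comp j) σ).subtype) F l).symm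
  obtain ⟨e, he, -, hef⟩ := h _ ((coinduced (q.comp j) σ).comp q)
    (fun φ => ⟨U, fun g hg => by
      rw [MonoidHom.comp_apply, show q g = 1 from (QuotientGroup.eq_one_iff g).2 hg]
      exact action_one _ φ⟩) F
    (fun g l => Subtype.ext <| funext fun x => by
      rw [MonoidHom.comp_apply, coinduced_apply]
      simp only [F, List.map_map]
      congr 2
      funext y
      simp [mul_assoc])
    ⟨U, fun l l' hl => Subtype.ext <| funext fun x =>
      congrArg (fun w => f (w.map fun y => r (x * y))) hl⟩
    (fun l hl => Subtype.ext <| funext fun x => (hFF l x).trans (hfc _ (by simpa using hl)))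
  -- Restriction to C followed by evaluation at 1 turns F back into f, since r ∘ q ∘ j is the
  -- identity.
  refine ⟨fun l => (e (l.map j)).1 1, fun c l => ?_, fun l hl => ?_⟩
  · have h1 : (l.map (c * ·)).map j = (l.map j).map (j c * ·) := by simp [Function.comp_def]
    have h2 := (e (l.map j)).2 c 1
    simp only [h1]
    rw [he (j c) (l.map j), ← h2, MonoidHom.comp_apply, coinduced_apply, mul_one, one_mul]
    rfl
  · have h1 := coboundary_comp_map j (fun w => (e w).1 1) l
    have h2 := coboundary_addMonoidHom ((Pi.evalAddMonoidHom (fun _ : G ⧸ U.toSubgroup => A) 1).comp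
      (coinducedGroup (q.comp j) σ).subtype) e (l.map j)
    refine h1.trans (h2.trans ?_)
    rw [hef _ (by simpa using hl)]
    change f (((l.map j).map q).map fun y => r (1 * y)) = f l
    congr 1
    have hrj' : ∀ c, r (q (j c)) = c := hrj
    simp [Function.comp_def, hrj']

lemma eq_one_of_isOfFinOrder [TotallyDisconnectedSpace G] {n : ℕ}
    (h : ∀ (B : Type u) [AddCommGroup B] [Finite B] (ρ : G →* AddMonoid.End B), IsSmooth ρ →
      IsContAcyclicAt ρ (n + 1)) {g : G} (hg : IsOfFinOrder g) : g = 1 := by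
  by_contra hne
  have hfin : Finite (Subgroup.zpowers g) := hg.finite_zpowers
  have : Nontrivial (Subgroup.zpowers g) := Subgroup.zpowers_ne_bot.2 hne |>
    (Subgroup.nontrivial_iff_ne_bot _).2
  -- U avoids the finitely many nontrivial powers of g, so ⟨g⟩ embeds in G/U.
  obtain ⟨U, hU⟩ := ProfiniteGrp.exist_openNormalSubgroup_sub_open_nhds_of_one
    (((Subgroup.zpowers g : Set G) \ {1}).toFinite.isClosed.isOpen_compl) (by simp)
  let _ : CommGroup (Subgroup.zpowers g) :=
    { (inferInstance : Group (Subgroup.zpowers g)) with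
      mul_comm x y := Std.Commutative.comm x y }
  refine not_isAcyclicAt_one (C := Subgroup.zpowers g)
    (isAcyclicAt_of_le (n := n + 1) (fun A _ _ σ =>
      isAcyclicAt_of_injective h (j := (Subgroup.zpowers g).subtype) (U := U) ?_ σ)
      (Nat.le_add_left 1 n) _ _)
  intro c hc
  by_contra hc1
  exact hU hc ⟨c.2, by simpa using hc1⟩

end ContinuousModules

/-! ### Application to the profinite completion. -/

/-- The finite-coefficient cohomology of the profinite completion of a good group vanishes above
the cohomological dimension. -/
lemma isContAcyclicAt_completion {H : Type u} [Group H] [TopologicalSpace H] [DiscreteTopology H]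
    {n : ℕ} (hgood : IsCohomologicallyGood H) (hcd : cd H = n) {k : ℕ} (hk : n < k)
    (B : Type u) [AddCommGroup B] [Finite B] (ρ : Completion H →* AddMonoid.End B)
    (hρ : IsSmooth ρ) : IsContAcyclicAt ρ k := by
  obtain ⟨k, rfl⟩ : ∃ m, k = m + 1 := ⟨k - 1, by omega⟩
  have hB := isDiscreteModule_discreteRep hρ
  -- The infimum defining `cd` is attained; the set is nonempty because ⊤ belongs to it vacuously.
  have hvan : ∀ k : ℕ, cd H < k → ∀ A : TopRep.{u} ℤ H, IsDiscreteModule A →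
      Subsingleton (continuousCohomology k A) :=
    csInf_mem (s := {n : ℕ∞ | ∀ k : ℕ, n < k → ∀ A : TopRep.{u} ℤ H, IsDiscreteModule A →
      Subsingleton (continuousCohomology k A)}) ⟨⊤, fun k hk => absurd hk not_top_lt⟩
  refine isContAcyclicAt_discreteRep ?_
  have := hvan (k + 1) (by rw [hcd]; exact_mod_cast hk)
    (TopRep.res (toCompletion H : H →* Completion H) (discreteRep ρ))
    { discrete := hB.discrete
      continuous_action := hB.continuous_action.comp
        (((toCompletion H).continuous_toFun.comp continuous_fst).prodMk continuous_snd) }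
  exact (hgood (discreteRep ρ) hB ‹Finite B› (k + 1)).injective.subsingleton

lemma profiniteCd_completion_le {H : Type u} [Group H] [TopologicalSpace H] [DiscreteTopology H]
    {n : ℕ} (hgood : IsCohomologicallyGood H) (hcd : cd H = n) :
    profiniteCd (Completion H) ≤ n := by
  refine iSup₂_le fun p _ => sInf_le fun k hk A hA htor x _ => ?_
  have hk : n < k := by exact_mod_cast hk
  obtain ⟨k, rfl⟩ : ∃ m, k = m + 1 := ⟨k - 1, by omega⟩
  have := hA.discrete
  have := (subsingleton_continuousCohomology_iff_isContAcyclicAt A k).2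
    (isContAcyclicAt_of_torsion (fun B _ _ ρ => isContAcyclicAt_completion hgood hcd hk B ρ)
      (isSmooth_additiveAction hA) htor)
  exact Subsingleton.elim _ _

end GoodGroups

end

theorem lemma3p3 {H : Type u} [Group H] [TopologicalSpace H] [DiscreteTopology H] (n : ℕ)
    (hgood : GoodGroups.IsCohomologicallyGood H) (hcd : GoodGroups.cd H = n) :
    GoodGroups.profiniteCd (GoodGroups.Completion H) ≤ n ∧
      ∀ g : GoodGroups.Completion H, IsOfFinOrder g → g = 1 :=
  ⟨GoodGroups.profiniteCd_completion_le hgood hcd, fun _ hg =>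
    GoodGroups.eq_one_of_isOfFinOrder
      (GoodGroups.isContAcyclicAt_completion hgood hcd n.lt_succ_self) hg⟩
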